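/- **Setting.** For an abelian category $\mathcal W$ let $D(\mathcal W)$ be its bounded derived category and $H^i$ the standard cohomology functors. Let $\mathcal Z$ be a noetherian abelian category (every object is noetherian) of homological dimension (at most) $2$, i.e. $\mathrm{Ext}^i_{\mathcal Z}(E,F)=\mathrm{Hom}_{D(\mathcal Z)}(E,F[i])=0$ for all $E,F\in\mathcal Z$ and $i\notin[0,2]$. Let $T\in\mathcal Z$, let $A=\mathrm{End}_{\mathcal Z}(T)$ be right noetherian, and let $\mathcal A=\mathrm{mod}\,A^{op}$ be the (abelian) category of finitely generated right $A$-modules. Suppose that $T$ is a tilting object: $\mathrm{Ext}^i_{\mathcal Z}(T,T)=0$ for $i\ne 0$, and $\Phi=R\mathrm{Hom}(T,-)$ is an equivalence $D(\mathcal Z)\to D(\mathcal A)$. (Of $\Phi$ it is only required that it is an equivalence of triangulated categories with isomorphisms of right $A$-modules $H^0(\Phi X)\cong \mathrm{Hom}_{D(\mathcal Z)}(T,X)$, natural in $X\in D(\mathcal Z)$; equivalently $H^i(\Phi X)\cong \mathrm{Hom}_{D(\mathcal Z)}(T,X[i])$ for all $i$.) Let $\Psi$ be a quasi-inverse of $\Phi$,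 and write $\Phi^i=H^i\circ\Phi$, $\Psi^i=H^i\circ\Psi$. Put $$\mathcal X_i=\{E\in\mathcal Z:\Phi^j(E)=0\ \forall j\neq i\},\quad \mathcal B_i=\{E\in\mathcal Z:\Phi^i(E)=0\},$$ $$\mathcal Y_i=\{M\in\mathcal A:\Psi^j(M)=0\ \forall j\neq i\},\quad \mathcal C_i=\{M\in\mathcal A:\Psi^i(M)=0\}.$$ For a full subcategory $\mathcal V$ of an abelian category $\mathcal W$ let $\mathcal V^\circ=\{E\in\mathcal W:\mathrm{Hom}(V,E)=0\ \forall V\in\mathcal V\}$. The tilt of $\mathcal W$ at a torsion pair $(\mathcal T',\mathcal F')$ is the full subcategory $\langle\mathcal F'[1],\mathcal T'\rangle$ of $D(\mathcal W)$ of all $X$ with $H^0(X)\in\mathcal T'$, $H^{-1}(X)\in\mathcal F'$ and $H^i(X)=0$ for $i\ne-1,0$. Let $\mathcal U_{2,1}\subseteq D(\mathcal Z)$ be the tilt of $\mathcal Z$ at $(\mathcal B_2,\mathcal B_0\cap\mathcal X_1^\circ)$, let $\mathcal H=\Psi(\mathcal A)$, and put $\mathcal T=\mathcal U_{2,1}\cap\mathcal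 H[-1]$ and $\mathcal F=(\mathcal U_{2,1}\cap\mathcal H)[-1]$. **Lemma 10.** 1. $(\mathcal B_2,\mathcal X_0^\circ\cap\mathcal X_1^\circ)$ is a torsion pair in $\mathcal Z$, and $\mathcal U_{2,1}$ is the tilt of $\mathcal Z$ at it; $\mathcal U_{2,1}$ is the heart of a bounded t-structure on $D(\mathcal Z)$. 2. $(\mathcal C_0,\mathcal Y_{-1}^\circ\cap\mathcal Y_{-2}^\circ)$ is a torsion pair in $\mathcal A$, and $\Phi(\mathcal U_{2,1})[1]$ is the tilt of $\mathcal A$ at it; $\Phi(\mathcal U_{2,1})[1]$ is the heart of a bounded t-structure on $D(\mathcal A)$. 3. This torsion pair is $(\Phi\mathcal T[1],\Phi\mathcal F[1])$: under the embedding of $\mathcal A$ in $D(\mathcal A)$ in degree $0$, $\Phi\mathcal T[1]=\mathcal C_0$ and $\Phi\mathcal F[1]=\mathcal Y_{-1}^\circ\cap\mathcal Y_{-2}^\circ$. -/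

import Mathlib

open CategoryTheory CategoryTheory.Limits

universe w₁ w₂ w v u

namespace TiltingTorsion

section BoundedDerivedCategory

variable (C : Type u) [Category.{v} C] [Abelian C] [HasDerivedCategory.{w} C]

/-- The bounded derived category `D(C) = D^b(C)`: the full triangulated subcategory of the derived
category whose objects have cohomology in finitely many degrees. -/
abbrev Db : Type max u v :=
  (DerivedCategory.TStructure.t (C := C)).bounded.FullSubcategory

namespace Db

/-- The embedding `C ⥤ D(C)` sending an object to the complex concentrated in degree `0`. -/
noncomputable def single : C ⥤ Db C :=
  ObjectProperty.lift _ (DerivedCategory.singleFunctor C 0)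
    (fun _ => ⟨⟨0, inferInstance⟩, ⟨0, inferInstance⟩⟩)

/-- The degree-`i` cohomology functor `H^i : D(C) ⥤ C` of the standard t-structure. -/
noncomputable def coh (i : ℤ) : Db C ⥤ C :=
  ObjectProperty.ι _ ⋙ DerivedCategory.homologyFunctor C i

end Db

/-- `C` has homological dimension (at most) `n`: for all objects `E, F` of `C`, the group
`Ext^i(E, F) = Hom_{D(C)}(E, F[i])` vanishes for every `i ∉ [0, n]`. -/
def HomologicalDimensionLE (n : ℤ) : Prop :=
  ∀ (E F : C) (i : ℤ), i ∉ Set.Icc 0 n →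
    ∀ f : (Db.single C).obj E ⟶ ((Db.single C).obj F)⟦i⟧, f = 0

end BoundedDerivedCategory

section TorsionPairs

/-- `(𝒯, ℱ)` is a torsion pair in the abelian category `W`: `𝒯` and `ℱ` are (isomorphism-closed)
full subcategories, there are no nonzero morphisms from `𝒯` to `ℱ`, and every object `E` sits in a
short exact sequence `0 ⟶ X ⟶ E ⟶ Y ⟶ 0` with `X ∈ 𝒯` and `Y ∈ ℱ`. -/
structure IsTorsionPair {W : Type u} [Category.{v} W] [Abelian W]
    (𝒯 ℱ : ObjectProperty W) : Prop where
  torsion_iso : 𝒯.IsClosedUnderIsomorphisms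
  torsionFree_iso : ℱ.IsClosedUnderIsomorphisms
  hom_eq_zero : ∀ ⦃X Y : W⦄, 𝒯 X → ℱ Y → ∀ f : X ⟶ Y, f = 0
  exists_shortExact : ∀ E : W, ∃ (X Y : W) (i : X ⟶ E) (p : E ⟶ Y) (h : i ≫ p = 0),
    (ShortComplex.mk i p h).ShortExact ∧ 𝒯 X ∧ ℱ Y

/-- The tilt of `W` at `(𝒯, ℱ)`: the full subcategory of `D(W)` of all `X` with `H^0(X) ∈ 𝒯`,
`H^{-1}(X) ∈ ℱ` and `H^i(X) = 0` for `i ≠ -1, 0`; in other words, `⟨ℱ[1], 𝒯⟩`. -/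
def tilt {W : Type u} [Category.{v} W] [Abelian W] [HasDerivedCategory.{w} W]
    (𝒯 ℱ : ObjectProperty W) : ObjectProperty (Db W) :=
  fun X => (∀ i : ℤ, i ≠ -1 → i ≠ 0 → IsZero ((Db.coh W i).obj X)) ∧
    ℱ ((Db.coh W (-1)).obj X) ∧ 𝒯 ((Db.coh W 0).obj X)

/-- `P` is the heart of a bounded t-structure on `D(W)`. -/
def IsBoundedHeart {W : Type u} [Category.{v} W] [Abelian W] [HasDerivedCategory.{w} W]
    (P : ObjectProperty (Db W)) : Prop :=
  ∃ t : Triangulated.TStructure (Db W), t.bounded = ⊤ ∧ t.heart = P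

/-- The (isomorphism-closed) subcategory `P[n]` of `D(W)`. -/
def shifted {W : Type u} [Category.{v} W] [Abelian W] [HasDerivedCategory.{w} W]
    (P : ObjectProperty (Db W)) (n : ℤ) : ObjectProperty (Db W) :=
  fun Y => ∃ X : Db W, P X ∧ Nonempty (X⟦n⟧ ≅ Y)

end TorsionPairs

section TiltingObject

variable {Z : Type u} [Category.{v} Z] [Abelian Z]

/-- The category `mod A^op` of finitely generated right modules over the endomorphism algebra
`A = Hom(T, T)`. In Mathlib the product of `A = End T` is `a * b = b ≫ a`, the usual composition of
endomorphisms, and right `A`-modules are left `Aᵐᵒᵖ`-modules. -/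
abbrev ModOp (T : Z) : Type (v + 1) := FGModuleCat.{v} (End T)ᵐᵒᵖ

variable [HasDerivedCategory.{w₁} Z] (T : Z) [IsNoetherianRing (End T)ᵐᵒᵖ]
  [HasDerivedCategory.{w₂} (ModOp T)]

/-- `Φ : D(Z) ⥤ D(mod A^op)` represents `Hom_{D(Z)}(T, -)` in degree `0`: there are isomorphisms of
right `A`-modules `H^0(Φ X) ≅ Hom_{D(Z)}(T, X)`, natural in `X ∈ D(Z)`, where `a ∈ A` acts on
`Hom_{D(Z)}(T, X)` by precomposition.  For a triangulated functor `Φ`, replacing `X` by `X[i]` this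
gives `H^i(Φ X) ≅ Hom_{D(Z)}(T, X[i])` for all `i`, the property that characterizes the values of
the derived functor `RHom(T, -)`. -/
def RepresentsHom (Φ : Db Z ⥤ Db (ModOp T)) : Prop :=
  ∃ e : ∀ X : Db Z,
      ((Db.coh (ModOp T) 0).obj (Φ.obj X)) ≃+ ((Db.single Z).obj T ⟶ X),
    (∀ (X Y : Db Z) (f : X ⟶ Y) (x : (Db.coh (ModOp T) 0).obj (Φ.obj X)),
      e Y (((Db.coh (ModOp T) 0).map (Φ.map f)).hom.hom x) = e X x ≫ f) ∧
    (∀ (X : Db Z) (a : End T) (x : (Db.coh (ModOp T) 0).obj (Φ.obj X)),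
      e X (MulOpposite.op a • x) = (Db.single Z).map a ≫ e X x)

/-- `T` is a tilting object of `Z`, with `Φ = RHom(T, -) : D(Z) ≌ D(mod A^op)`: `T` has no
self-extensions in nonzero degrees, and `Φ` is an equivalence of triangulated categories whose
cohomology is `Hom_{D(Z)}(T, -)`. -/
structure IsTilting (Φ : Db Z ≌ Db (ModOp T)) [Φ.functor.CommShift ℤ] : Prop where
  ext_eq_zero : ∀ i : ℤ, i ≠ 0 →
    ∀ f : (Db.single Z).obj T ⟶ ((Db.single Z).obj T)⟦i⟧, f = 0
  isTriangulated : Φ.functor.IsTriangulated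
  representsHom : RepresentsHom T Φ.functor

end TiltingObject

/-! The subcategories attached to an equivalence `Φ : D(Z) ≌ D(A)` with quasi-inverse
`Ψ = Φ.inverse`; write `Φ^i = H^i ∘ Φ` and `Ψ^i = H^i ∘ Ψ`. -/

section Subcategories

variable {Z : Type*} [Category* Z] [Abelian Z] [HasDerivedCategory.{w₁} Z]
  {A : Type*} [Category* A] [Abelian A] [HasDerivedCategory.{w₂} A]
  (Φ : Db Z ≌ Db A)

/-- `Φ^i(E)` for `E ∈ Z`. -/
noncomputable def phiCoh (i : ℤ) (E : Z) : A :=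
  (Db.coh A i).obj (Φ.functor.obj ((Db.single Z).obj E))

/-- `Ψ^i(M)` for `M ∈ A`. -/
noncomputable def psiCoh (i : ℤ) (M : A) : Z :=
  (Db.coh Z i).obj (Φ.inverse.obj ((Db.single A).obj M))

/-- `𝒳_i = {E ∈ Z : Φ^j(E) = 0 for all j ≠ i}`. -/
def catX (i : ℤ) : ObjectProperty Z := fun E => ∀ j : ℤ, j ≠ i → IsZero (phiCoh Φ j E)

/-- `ℬ_i = {E ∈ Z : Φ^i(E) = 0}`. -/
def catB (i : ℤ) : ObjectProperty Z := fun E => IsZero (phiCoh Φ i E)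

/-- `𝒴_i = {M ∈ A : Ψ^j(M) = 0 for all j ≠ i}`. -/
def catY (i : ℤ) : ObjectProperty A := fun M => ∀ j : ℤ, j ≠ i → IsZero (psiCoh Φ j M)

/-- `𝒞_i = {M ∈ A : Ψ^i(M) = 0}`. -/
def catC (i : ℤ) : ObjectProperty A := fun M => IsZero (psiCoh Φ i M)

/-- `𝒰_{2,1}`: the tilt of `Z` at `(ℬ_2, ℬ_0 ∩ 𝒳_1°)`, a full subcategory of `D(Z)`. -/
def catU : ObjectProperty (Db Z) :=
  tilt (catB Φ 2) (catB Φ 0 ⊓ (catX Φ 1).rightOrthogonal)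

/-- `ℋ = Ψ(A)`, a full subcategory of `D(Z)`. -/
def catH : ObjectProperty (Db Z) := (⊤ : ObjectProperty A).map (Db.single A ⋙ Φ.inverse)

/-- `𝒯 = 𝒰_{2,1} ∩ ℋ[-1]`. -/
def tors : ObjectProperty (Db Z) := catU Φ ⊓ shifted (catH Φ) (-1)

/-- `ℱ = (𝒰_{2,1} ∩ ℋ)[-1]`. -/
def torsFree : ObjectProperty (Db Z) := shifted (catU Φ ⊓ catH Φ) (-1)

/-- For a full subcategory `P` of `D(Z)`, the full subcategory `Φ(P)[1]` of `D(A)`. -/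
def imageShift (P : ObjectProperty (Db Z)) : ObjectProperty (Db A) :=
  shifted (P.map Φ.functor) 1

end Subcategories

end TiltingTorsion

namespace TiltingTorsion

open Pretriangulated Triangulated

/-! Everything follows from one property of `Φ`, its amplitude `[a, a + 2]` (`HasAmplitude`; here `a
= 0`, from the homological dimension). By orthogonality the inverse `Ψ` has amplitude `[-2 - a,
-a]`, so each statement about `Z` applies verbatim to `mod A^op` with `Φ.symm`, and `𝒞_{-a}` plays
the role of `ℬ_{a+2}`.

The bound makes `ℬ_{a+2}` closed under quotients and extensions, hence the torsion part of a torsion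
pair in a noetherian category. Its right orthogonal is found by a cycle of inclusions: `ℬ_{a+2}° ⊆
𝒳_a° ∩ 𝒳_{a+1}° ⊆ ℬ_a ∩ 𝒳_{a+1}° ⊆ ℬ_{a+2}°`. The middle one is `rightOrthogonal_catX_le`, the last
`catB_inf_rightOrthogonal_le`.

The tilted aisle consists of the `X` in `D^{≤ n}` with `Φ(X)` in `D^{≤ n + a + 1}`
(`tiltTStructure_isLE_iff`). This description is symmetric in `Φ` and `Ψ`, so `Φ` matches the two
tilted t-structures, and therefore their hearts, up to a shift by `a + 1`. The torsion and
torsion-free parts are then read off from which `M` and which `M[1]` lie in the tilted heart. -/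

lemma exists_distinguished_of_map_ι {C : Type*} [Category* C] [Preadditive C] [HasZeroObject C]
    [HasShift C ℤ] [∀ n : ℤ, (shiftFunctor C n).Additive] [Pretriangulated C]
    (P : ObjectProperty C) [P.IsTriangulated] {X₁ X₂ X₃ : P.FullSubcategory}
    (f : X₁ ⟶ X₂) (g : X₂ ⟶ X₃) (δ : P.ι.obj X₃ ⟶ (P.ι.obj X₁)⟦(1 : ℤ)⟧)
    (hT : Triangle.mk (P.ι.map f) (P.ι.map g) δ ∈ distTriang C) :
    ∃ δ' : X₃ ⟶ X₁⟦(1 : ℤ)⟧, Triangle.mk f g δ' ∈ distTriang P.FullSubcategory := by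
  let δ' : X₃ ⟶ X₁⟦(1 : ℤ)⟧ := P.fullyFaithfulι.preimage (δ ≫ (P.ι.commShiftIso (1 : ℤ)).inv.app X₁)
  have hδ' : P.ι.map δ' = δ ≫ (P.ι.commShiftIso (1 : ℤ)).inv.app X₁ :=
    P.fullyFaithfulι.map_preimage _
  refine ⟨δ', isomorphic_distinguished _ hT _
    (Triangle.isoMk _ _ (Iso.refl _) (Iso.refl _) (Iso.refl _) ?_ ?_ ?_)⟩
  · exact (Category.comp_id _).trans (Category.id_comp _).symm
  · exact (Category.comp_id _).trans (Category.id_comp _).symm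
  · change (P.ι.map δ' ≫ (P.ι.commShiftIso (1 : ℤ)).hom.app X₁) ≫
      (shiftFunctor C (1 : ℤ)).map (𝟙 (P.ι.obj X₁)) = 𝟙 (P.ι.obj X₃) ≫ δ
    rw [hδ', CategoryTheory.Functor.map_id]
    refine (Category.comp_id _).trans ((Category.assoc _ _ _).trans ?_)
    rw [Iso.inv_hom_id_app]
    exact (Category.comp_id _).trans (Category.id_comp _).symm

/-! ### The standard t-structure and cohomology on the bounded derived category. -/

namespace Db

variable {W : Type u} [Category.{v} W] [Abelian W] [HasDerivedCategory.{w} W]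

/-- The standard t-structure on the bounded derived category. -/
noncomputable abbrev t : TStructure (Db W) := DerivedCategory.TStructure.t.onBounded

lemma isLE_iff (X : Db W) (n : ℤ) :
    t.IsLE X n ↔ ∀ i : ℤ, n < i → IsZero ((coh W i).obj X) :=
  (ObjectProperty.tStructure_isLE_iff _ _ X n).trans (DerivedCategory.isLE_iff X.obj n)

lemma isGE_iff (X : Db W) (n : ℤ) :
    t.IsGE X n ↔ ∀ i : ℤ, i < n → IsZero ((coh W i).obj X) :=
  (ObjectProperty.tStructure_isGE_iff _ _ X n).trans (DerivedCategory.isGE_iff X.obj n)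

instance (n : ℤ) : (coh W n).Additive := by
  dsimp [coh]; infer_instance

instance : (single W).Full where
  map_surjective f := by
    obtain ⟨g, hg⟩ := (DerivedCategory.singleFunctor W 0).map_surjective f.hom
    exact ⟨g, ObjectProperty.hom_ext _ hg⟩

instance : (single W).Faithful where
  map_injective {_ _ f _} h :=
    (DerivedCategory.singleFunctor W 0).map_injective
      (congr_arg (ObjectProperty.ι _).map h : (single W ⋙ ObjectProperty.ι _).map f = _)

instance : (single W).Additive where
  map_add {X Y f g} := by
    apply ObjectProperty.hom_ext
    exact (DerivedCategory.singleFunctor W 0).map_add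

instance (M : W) : t.IsLE ((single W).obj M) 0 :=
  (ObjectProperty.tStructure_isLE_iff _ _ _ _).2
    (inferInstanceAs (((DerivedCategory.singleFunctor W 0).obj M).IsLE 0))
instance (M : W) : t.IsGE ((single W).obj M) 0 :=
  (ObjectProperty.tStructure_isGE_iff _ _ _ _).2
    (inferInstanceAs (((DerivedCategory.singleFunctor W 0).obj M).IsGE 0))

lemma exists_iso_single (X : Db W) [hX : t.IsLE X 0] [hX' : t.IsGE X 0] :
    ∃ M : W, Nonempty (X ≅ (single W).obj M) := by
  rw [ObjectProperty.tStructure_isLE_iff] at hX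
  rw [ObjectProperty.tStructure_isGE_iff] at hX'
  obtain ⟨M, ⟨e⟩⟩ := DerivedCategory.exists_iso_singleFunctor_obj_of_isGE_of_isLE X.obj 0
  exact ⟨M, ⟨ObjectProperty.isoMk _ e⟩⟩

lemma exists_isLE (X : Db W) : ∃ n, t.IsLE X n := by
  obtain ⟨-, n, h⟩ := X.property
  exact ⟨n, (ObjectProperty.tStructure_isLE_iff _ _ _ _).2 h⟩
lemma exists_isGE (X : Db W) : ∃ n, t.IsGE X n := by
  obtain ⟨⟨n, h⟩, -⟩ := X.property
  exact ⟨n, (ObjectProperty.tStructure_isGE_iff _ _ _ _).2 h⟩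

/-- `H^n(X⟦a⟧) ≅ H^m(X)` for `a + n = m`. -/
noncomputable def cohShiftIso (a n m : ℤ) (h : a + n = m) (X : Db W) :
    (coh W n).obj (X⟦a⟧) ≅ (coh W m).obj X :=
  (DerivedCategory.homologyFunctor W n).mapIso
      ((ObjectProperty.ι _).commShiftIso a |>.app X) ≪≫
    ((DerivedCategory.homologyFunctor W 0).shiftIso a n m h).app X.obj

/-- `H^0(M) ≅ M` for `M` in degree `0`. -/
noncomputable def cohSingleIso (M : W) : (coh W 0).obj ((single W).obj M) ≅ M :=
  (DerivedCategory.singleFunctorCompHomologyFunctorIso W 0).app M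

lemma coh_mono₁ (T : Triangle (Db W)) (hT : T ∈ distTriang _) (n m : ℤ) (h : n + 1 = m)
    (h₃ : IsZero ((coh W n).obj T.obj₃)) : Mono ((coh W m).map T.mor₁) := by
  refine (DerivedCategory.HomologySequence.mono_homologyMap_mor₁_iff _
    ((ObjectProperty.ι _).map_distinguished T hT) n m h).2 (h₃.eq_of_src _ _)

lemma coh_epi₁ (T : Triangle (Db W)) (hT : T ∈ distTriang _) (n : ℤ)
    (h₃ : IsZero ((coh W n).obj T.obj₃)) : Epi ((coh W n).map T.mor₁) := by
  refine (DerivedCategory.HomologySequence.epi_homologyMap_mor₁_iff _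
    ((ObjectProperty.ι _).map_distinguished T hT) n).2 (h₃.eq_of_tgt _ _)

lemma coh_mono₂ (T : Triangle (Db W)) (hT : T ∈ distTriang _) (n : ℤ)
    (h₁ : IsZero ((coh W n).obj T.obj₁)) : Mono ((coh W n).map T.mor₂) := by
  refine (DerivedCategory.HomologySequence.mono_homologyMap_mor₂_iff _
    ((ObjectProperty.ι _).map_distinguished T hT) n).2 (h₁.eq_of_src _ _)

lemma coh_epi₂ (T : Triangle (Db W)) (hT : T ∈ distTriang _) (n m : ℤ) (h : n + 1 = m)
    (h₁ : IsZero ((coh W m).obj T.obj₁)) : Epi ((coh W n).map T.mor₂) := by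
  refine (DerivedCategory.HomologySequence.epi_homologyMap_mor₂_iff _
    ((ObjectProperty.ι _).map_distinguished T hT) n m h).2 (h₁.eq_of_tgt _ _)

lemma coh_isIso₁ (T : Triangle (Db W)) (hT : T ∈ distTriang _) (n m : ℤ) (h : n + 1 = m)
    (h₃ : IsZero ((coh W n).obj T.obj₃)) (h₃' : IsZero ((coh W m).obj T.obj₃)) :
    IsIso ((coh W m).map T.mor₁) :=
  have := coh_mono₁ T hT n m h h₃
  have := coh_epi₁ T hT m h₃'
  isIso_of_mono_of_epi _

lemma coh_isIso₂ (T : Triangle (Db W)) (hT : T ∈ distTriang _) (n m : ℤ) (h : n + 1 = m)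
    (h₁ : IsZero ((coh W n).obj T.obj₁)) (h₁' : IsZero ((coh W m).obj T.obj₁)) :
    IsIso ((coh W n).map T.mor₂) :=
  have := coh_mono₂ T hT n h₁
  have := coh_epi₂ T hT n m h h₁'
  isIso_of_mono_of_epi _

/-- A short exact sequence in `W` gives a distinguished triangle in `D(W)`. -/
lemma exists_triangle_of_shortExact {S : ShortComplex W} (hS : S.ShortExact) :
    ∃ δ : (single W).obj S.X₃ ⟶ ((single W).obj S.X₁)⟦(1 : ℤ)⟧,
      Triangle.mk ((single W).map S.f) ((single W).map S.g) δ ∈ distTriang (Db W) :=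
  exists_distinguished_of_map_ι _ ((single W).map S.f) ((single W).map S.g) hS.singleδ
    hS.singleTriangle_distinguished

end Db

section Triangles

variable {C : Type*} [Category* C] [Preadditive C] [HasZeroObject C] [HasShift C ℤ]
  [∀ n : ℤ, (shiftFunctor C n).Additive] [Pretriangulated C]

lemma exists_desc_of_distinguished {X₁ X₂ X₃ Y : C} {f : X₁ ⟶ X₂} {g : X₂ ⟶ X₃}
    {δ : X₃ ⟶ X₁⟦(1 : ℤ)⟧} (hT : Triangle.mk f g δ ∈ distTriang C) (k : X₂ ⟶ Y)
    (hk : f ≫ k = 0) : ∃ l : X₃ ⟶ Y, k = g ≫ l :=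
  Triangle.yoneda_exact₂ _ hT k hk

lemma exists_lift_of_distinguished {X₁ X₂ X₃ Y : C} {f : X₁ ⟶ X₂} {g : X₂ ⟶ X₃}
    {δ : X₃ ⟶ X₁⟦(1 : ℤ)⟧} (hT : Triangle.mk f g δ ∈ distTriang C) (k : Y ⟶ X₂)
    (hk : k ≫ g = 0) : ∃ l : Y ⟶ X₁, k = l ≫ f :=
  Triangle.coyoneda_exact₂ _ hT k hk

lemma exists_truncation_triangle [IsTriangulated C] (t : TStructure C) (X : C) (n m : ℤ)
    (h : n + 1 = m) :
    ∃ (A B : C) (i : A ⟶ X) (p : X ⟶ B) (δ : B ⟶ A⟦(1 : ℤ)⟧),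
      Triangle.mk i p δ ∈ distTriang C ∧ t.IsLE A n ∧ t.IsGE B m ∧
      (∀ a, t.IsGE X a → t.IsGE A a) ∧ (∀ b, t.IsLE X b → t.IsLE B b) :=
  ⟨(t.truncLT m).obj X, (t.truncGE m).obj X, (t.truncLTι m).app X, (t.truncGEπ m).app X,
    (t.truncGEδLT m).app X, t.triangleLTGE_distinguished m X, t.isLE_truncLT_obj .., inferInstance,
    fun _ _ => inferInstance, fun _ _ => inferInstance⟩

end Triangles

/-! ### Tilting the standard t-structure at a torsion pair. -/

section Tilt

variable {W : Type u} [Category.{v} W] [Abelian W]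

lemma IsTorsionPair.prop_of_isZero_left {𝒯 ℱ : ObjectProperty W} (h : IsTorsionPair 𝒯 ℱ) {E : W}
    (hE : IsZero E) : 𝒯 E := by
  obtain ⟨X, Y, i, p, w, hS, hX, -⟩ := h.exists_shortExact E
  have := hS.mono_f
  have hX' : IsZero X := IsZero.of_mono i hE
  exact h.torsion_iso.of_iso (hX'.iso hE) hX

lemma IsTorsionPair.prop_of_isZero_right {𝒯 ℱ : ObjectProperty W} (h : IsTorsionPair 𝒯 ℱ) {E : W}
    (hE : IsZero E) : ℱ E := by
  obtain ⟨X, Y, i, p, w, hS, -, hY⟩ := h.exists_shortExact E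
  have := hS.epi_g
  have hY' : IsZero Y := IsZero.of_epi p hE
  exact h.torsionFree_iso.of_iso (hY'.iso hE) hY

variable [HasDerivedCategory.{w} W]

namespace Db

lemma eq_zero_of_coh_single_map {M N : W} (k : M ⟶ N)
    (hk : (coh W 0).map ((single W).map k) = 0) : k = 0 := by
  have h := (DerivedCategory.singleFunctorCompHomologyFunctorIso W 0).inv.naturality k
  have h' : (DerivedCategory.singleFunctor W 0 ⋙ DerivedCategory.homologyFunctor W 0).map k = 0 :=
    hk
  rw [h', comp_zero, Functor.id_map] at h
  rwa [← cancel_mono ((DerivedCategory.singleFunctorCompHomologyFunctorIso W 0).inv.app N),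
    zero_comp]

lemma eq_zero_of_coh_map_of_heart {X Y : Db W} [t.IsLE X 0] [t.IsGE X 0] [t.IsLE Y 0]
    [t.IsGE Y 0] (f : X ⟶ Y) (hf : (coh W 0).map f = 0) : f = 0 := by
  obtain ⟨M, ⟨e⟩⟩ := exists_iso_single X
  obtain ⟨N, ⟨e'⟩⟩ := exists_iso_single Y
  obtain ⟨k, hk⟩ := (single W).map_surjective (e.inv ≫ f ≫ e'.hom)
  have hk0 : k = 0 := eq_zero_of_coh_single_map k (by
    rw [hk, Functor.map_comp, Functor.map_comp, hf, zero_comp, comp_zero])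
  rw [hk0, Functor.map_zero] at hk
  rw [← cancel_epi e.inv, ← cancel_mono e'.hom, comp_zero, zero_comp, Category.assoc, hk]

/-- A morphism from `D^{≤ 0}` to `D^{≥ 0}` vanishes if it does so on `H^0`. -/
lemma eq_zero_of_coh_map {X Y : Db W} [hX : t.IsLE X 0] [hY : t.IsGE Y 0] (f : X ⟶ Y)
    (hf : (coh W 0).map f = 0) : f = 0 := by
  obtain ⟨A, B, i, p, δ, hT, hA, hB, -, hB'⟩ := exists_truncation_triangle t X (-1) 0 rfl
  obtain ⟨A', B', i', p', δ', hT', hA', hB₁, hA₁, -⟩ := exists_truncation_triangle t Y 0 1 rfl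
  have := hB' 0 hX
  have := hA₁ 0 hY
  -- `f` factors as `X ⟶ τ^{≥ 0} X ⟶ τ^{≤ 0} Y ⟶ Y`. The middle map lies in the heart, and the outer
  -- two are respectively epi and mono on `H^0`, so `H^0` of the middle map vanishes too.
  obtain ⟨g, hg⟩ := exists_desc_of_distinguished hT f (t.zero _ (-1) 0)
  obtain ⟨h, hh⟩ := exists_lift_of_distinguished hT' g (t.zero _ 0 1)
  have e : Epi ((coh W 0).map p) := coh_epi₂ _ hT 0 1 rfl ((isLE_iff _ _).1 hA 1 (by lia))
  have m : Mono ((coh W 0).map i') :=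
    coh_mono₁ _ hT' (-1) 0 rfl ((isGE_iff _ _).1 hB₁ (-1) (by lia))
  have h0 : (coh W 0).map h = 0 := by
    rw [← cancel_epi ((coh W 0).map p), ← cancel_mono ((coh W 0).map i'), comp_zero, zero_comp,
      ← Functor.map_comp, ← Functor.map_comp, Category.assoc, ← hh, ← hg, hf]
  rw [hg, hh, eq_zero_of_coh_map_of_heart h h0, zero_comp, comp_zero]

/-- The object `X` of `D^{≤ 0}` maps to `H^0(X)`, with cocone in `D^{≤ -1}`. -/
lemma exists_triangle_to_single (X : Db W) [t.IsLE X 0] :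
    ∃ (K : Db W) (M : W) (i : K ⟶ X) (p : X ⟶ (single W).obj M)
      (δ : (single W).obj M ⟶ K⟦(1 : ℤ)⟧), t.IsLE K (-1) ∧
      Triangle.mk i p δ ∈ distTriang (Db W) := by
  obtain ⟨A, B, i, p, δ, hT, hA, hB, -, hB'⟩ := exists_truncation_triangle t X (-1) 0 rfl
  have := hB' 0 inferInstance
  obtain ⟨M, ⟨e⟩⟩ := exists_iso_single B
  refine ⟨A, M, i, p ≫ e.hom, e.inv ≫ δ, hA, isomorphic_distinguished _ hT _
    (Triangle.isoMk _ _ (Iso.refl _) (Iso.refl _) e.symm ?_ ?_ ?_)⟩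
  all_goals simp [Triangle.mk]

end Db

open Db

lemma exists_tilt_triangle {𝒯 ℱ : ObjectProperty W} (h : IsTorsionPair 𝒯 ℱ) (X : Db W) :
    ∃ (A B : Db W) (f : A ⟶ X) (g : X ⟶ B) (δ : B ⟶ A⟦(1 : ℤ)⟧),
      Triangle.mk f g δ ∈ distTriang (Db W) ∧ (t.IsLE A 0 ∧ 𝒯 ((coh W 0).obj A)) ∧
      (t.IsGE B 0 ∧ ℱ ((coh W 0).obj B)) := by
  obtain ⟨X₁, X₃, u, u', u'', hX, i₁, i₃, -, -⟩ := exists_truncation_triangle t X 0 1 rfl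
  obtain ⟨K, M, i, p, δ, hK, hT⟩ := exists_triangle_to_single X₁
  obtain ⟨E, Q, a, b, w, hS, hE, hQ⟩ := h.exists_shortExact M
  obtain ⟨δ', hT'⟩ := exists_triangle_of_shortExact hS
  -- `A` is the part of `τ^{≤ 0} X` left after removing the torsion-free quotient `Q` of `H^0(X)`.
  obtain ⟨A, c, d, hA⟩ := distinguished_cocone_triangle₁ (p ≫ (single W).map b)
  obtain ⟨B, g, d', hB⟩ := distinguished_cocone_triangle (c ≫ u)
  -- The first octahedron exhibits `B` as an extension of `τ^{≥ 1} X` by `Q`; the second exhibits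
  -- `A[1]` as an extension of `E[1]` by `K[1]`. Hence `H^0(B) ≅ Q` and `H^0(A) ≅ E`.
  have o₁ := (someOctahedron rfl hA hX hB).mem
  have o₂ := (someOctahedron rfl (rot_of_distTriang _ hT) (rot_of_distTriang _ hT')
    (rot_of_distTriang _ hA)).mem
  have hK' : t.IsLE (K⟦(1 : ℤ)⟧) (-2) := t.isLE_shift K (-1) 1 (-2)
  have hE' : t.IsLE (((single W).obj E)⟦(1 : ℤ)⟧) (-1) := t.isLE_shift _ 0 1 (-1)
  have hA' : t.IsLE (A⟦(1 : ℤ)⟧) (-1) := t.isLE₂ _ o₂ (-1) (t.isLE_of_le (K⟦(1 : ℤ)⟧) (-2) (-1)) hE'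
  have i₃' := t.isGE_of_ge X₃ 0 1
  refine ⟨A, B, _, g, d', hB, ⟨t.isLE_of_shift A 0 1 (-1), ?_⟩,
    t.isGE₂ _ o₁ 0 (inferInstanceAs (t.IsGE ((single W).obj Q) 0)) i₃', ?_⟩
  · have := coh_isIso₂ _ o₂ (-1) 0 rfl ((isLE_iff _ _).1 hK' _ (by lia))
      ((isLE_iff _ _).1 hK' _ (by lia))
    exact h.torsion_iso.of_iso ((cohSingleIso E).symm ≪≫ (cohShiftIso 1 (-1) 0 rfl _).symm ≪≫
      (@asIso _ _ _ _ _ this).symm ≪≫ cohShiftIso 1 (-1) 0 rfl A) hE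
  · have := coh_isIso₁ _ o₁ (-1) 0 rfl ((isGE_iff _ _).1 i₃ _ (by lia))
      ((isGE_iff _ _).1 i₃ _ (by lia))
    exact h.torsionFree_iso.of_iso ((cohSingleIso Q).symm ≪≫ @asIso _ _ _ _ _ this) hQ

/-- The t-structure on `D(W)` obtained by tilting the standard one at a torsion pair. -/
noncomputable def tiltTStructure {𝒯 ℱ : ObjectProperty W} (h : IsTorsionPair 𝒯 ℱ) :
    TStructure (Db W) where
  le n X := t.IsLE X n ∧ 𝒯 ((coh W n).obj X)
  -- The index `n - 1` places `ℱ` in degree `-1` of the heart, and makes `le 0` and `ge 1` meet only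
  -- in `H^0`, where the torsion pair gives the vanishing.
  ge n X := t.IsGE X (n - 1) ∧ ℱ ((coh W (n - 1)).obj X)
  le_isClosedUnderIsomorphisms n :=
    ⟨fun e ⟨_, hX⟩ => ⟨t.isLE_of_iso e n, h.torsion_iso.of_iso ((coh W n).mapIso e) hX⟩⟩
  ge_isClosedUnderIsomorphisms n :=
    ⟨fun e ⟨_, hX⟩ => ⟨t.isGE_of_iso e _, h.torsionFree_iso.of_iso ((coh W _).mapIso e) hX⟩⟩
  le_shift n a n' w X hX :=
    have := hX.1
    ⟨t.isLE_shift X n a n', h.torsion_iso.of_iso (cohShiftIso a n' n w X).symm hX.2⟩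
  ge_shift n a n' w X hX :=
    have := hX.1
    ⟨t.isGE_shift X (n - 1) a (n' - 1),
      h.torsionFree_iso.of_iso (cohShiftIso a (n' - 1) (n - 1) (by lia) X).symm hX.2⟩
  zero' X Y f hX hY :=
    have := hX.1
    have : t.IsGE Y 0 := hY.1
    eq_zero_of_coh_map f (h.hom_eq_zero hX.2 hY.2 _)
  le_zero_le X hX :=
    have := hX.1
    ⟨t.isLE_of_le X 0 1, h.prop_of_isZero_left ((isLE_iff X 0).1 hX.1 1 (by lia))⟩
  ge_one_le X hX :=
    have := hX.1
    ⟨t.isGE_of_ge X _ (1 - 1), h.prop_of_isZero_right ((isGE_iff X _).1 hX.1 _ (by lia))⟩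
  exists_triangle_zero_one X := by
    obtain ⟨A, B, f, g, δ, hT, hA, hB⟩ := exists_tilt_triangle h X
    exact ⟨A, B, hA, hB, f, g, δ, hT⟩

lemma tiltTStructure_heart {𝒯 ℱ : ObjectProperty W} (h : IsTorsionPair 𝒯 ℱ) :
    (tiltTStructure h).heart = tilt 𝒯 ℱ := by
  ext X
  constructor
  · rintro ⟨⟨h₁, h₂⟩, h₃, h₄⟩
    refine ⟨fun i hi hi' => ?_, h₄, h₂⟩
    rcases lt_or_gt_of_ne hi' with hi' | hi'
    · exact (isGE_iff _ _).1 h₃ i (by lia)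
    · exact (isLE_iff _ _).1 h₁ i hi'
  · rintro ⟨h₁, h₂, h₃⟩
    exact ⟨⟨(isLE_iff _ _).2 fun i hi => h₁ i (by lia) (by lia), h₃⟩,
      (isGE_iff _ _).2 fun i hi => h₁ i (by lia) (by lia), h₂⟩

lemma tiltTStructure_bounded {𝒯 ℱ : ObjectProperty W} (h : IsTorsionPair 𝒯 ℱ) :
    (tiltTStructure h).bounded = ⊤ := by
  refine top_le_iff.1 fun X _ => ?_
  obtain ⟨a, ha⟩ := exists_isGE X
  obtain ⟨b, hb⟩ := exists_isLE X
  exact ⟨⟨a, ⟨t.isGE_of_ge X (a - 1) a, h.prop_of_isZero_right ((isGE_iff X a).1 ha _ (by lia))⟩⟩,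
    b + 1, ⟨t.isLE_of_le X b (b + 1), h.prop_of_isZero_left ((isLE_iff X b).1 hb _ (by lia))⟩⟩

lemma isBoundedHeart_tilt {𝒯 ℱ : ObjectProperty W} (h : IsTorsionPair 𝒯 ℱ) :
    IsBoundedHeart (tilt (W := W) 𝒯 ℱ) :=
  ⟨tiltTStructure h, tiltTStructure_bounded h, tiltTStructure_heart h⟩

end Tilt

/-! ### Torsion pairs from noetherianity. -/

section Noetherian

/-- In a noetherian abelian category, a full subcategory closed under quotients and extensions is
the torsion part of a torsion pair. -/
lemma isTorsionPair_rightOrthogonal {W : Type u} [Category.{v} W] [Abelian W]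
    (hW : ∀ E : W, IsNoetherianObject E) (P : ObjectProperty W) [P.IsClosedUnderQuotients]
    [P.IsClosedUnderExtensions] [P.ContainsZero] [P.IsClosedUnderIsomorphisms] :
    IsTorsionPair P P.rightOrthogonal where
  torsion_iso := inferInstance
  torsionFree_iso := inferInstance
  hom_eq_zero X Y hX hY f := hY f hX
  exists_shortExact E := by
    have := hW E
    have hbot : P ((⊥ : Subobject E) : W) := P.prop_of_isZero
      ((isZero_zero W).of_iso Subobject.botCoeIsoZero)
    -- The torsion part is a maximal subobject in `P`; its quotient must be shown to receive no
    -- nonzero map from `P`.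
    obtain ⟨S, hS, hmax⟩ := (wellFounded_gt (α := Subobject E)).has_min
      {S : Subobject E | P (S : W)} ⟨⊥, hbot⟩
    let π := cokernel.π S.arrow
    have hex : (ShortComplex.mk S.arrow π (cokernel.condition _)).Exact :=
      ShortComplex.exact_cokernel S.arrow
    refine ⟨S, cokernel S.arrow, S.arrow, π, cokernel.condition _,
      { exact := hex, mono_f := inferInstance, epi_g := inferInstanceAs (Epi (cokernel.π _)) },
      hS, fun V f hV => ?_⟩
    have : Epi π := inferInstanceAs (Epi (cokernel.π _))
    -- The pullback of `f` along `E ⟶ E/S` is an extension of `V` by `S`, so it lies in `P`. Its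
    -- image in `E` lies in `P` and contains `S`, so equals `S` by maximality, which forces `f = 0`.
    let k : (S : W) ⟶ pullback f π := pullback.lift 0 S.arrow (by simp [π])
    have hk : k ≫ pullback.fst f π = 0 := pullback.lift_fst _ _ _
    have hk' : k ≫ pullback.snd f π = S.arrow := pullback.lift_snd _ _ _
    have hk_mono : Mono k := mono_of_mono_fac hk'
    have hses : (ShortComplex.mk k (pullback.fst f π) hk).ShortExact :=
      { exact := by
          apply ShortComplex.exact_of_f_is_kernel
          refine KernelFork.IsLimit.ofι' _ _ fun {A} x hx => ?_
          have hx' : (x ≫ pullback.snd f π) ≫ π = 0 := by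
            rw [Category.assoc, ← pullback.condition, reassoc_of% hx, zero_comp]
          have : Mono (ShortComplex.mk S.arrow π (cokernel.condition _)).f :=
            inferInstanceAs (Mono S.arrow)
          refine ⟨hex.lift _ hx', pullback.hom_ext ?_ ?_⟩
          · simp only [Category.assoc]
            rw [hk, comp_zero, hx]
          · simp only [Category.assoc]
            rw [hk']
            exact hex.lift_f _ hx'
        mono_f := hk_mono
        epi_g := inferInstanceAs (Epi (pullback.fst f π)) }
    have hpb : P (pullback f π) := P.prop_X₂_of_shortExact hses hS hV
    let I := imageSubobject (pullback.snd f π)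
    have hI : P (I : W) := P.prop_of_epi (factorThruImageSubobject (pullback.snd f π)) hpb
    have hSI : S ≤ I := Subobject.le_of_comm (k ≫ factorThruImageSubobject _) (by simp [I, hk'])
    have hIS : I ≤ S := (hSI.eq_or_lt.resolve_right (hmax I hI)).ge
    have hI0 : I.arrow ≫ π = 0 := by
      rw [← Subobject.ofLE_arrow hIS, Category.assoc, cokernel.condition, comp_zero]
    rw [← cancel_epi (pullback.fst f π), pullback.condition, comp_zero,
      ← imageSubobject_arrow_comp (pullback.snd f π), Category.assoc, hI0, comp_zero]

/-- Taking ranges embeds subobjects strictly monotonically into the submodules of `M`, where the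
ascending chain condition holds. -/
lemma isNoetherianObject_fgModuleCat {R : Type u} [Ring R] [IsNoetherianRing R]
    (M : FGModuleCat.{v} R) : IsNoetherianObject M := by
  let r (S : Subobject M) : Submodule R M := LinearMap.range S.arrow.hom.hom
  have hr : StrictMono r := by
    have hle {S S' : Subobject M} (h : S ≤ S') : r S ≤ r S' := by
      rintro _ ⟨x, rfl⟩
      exact ⟨(Subobject.ofLE S S' h).hom.hom x,
        congr_arg (fun f => f.hom.hom x) (Subobject.ofLE_arrow h)⟩
    refine fun S S' h => lt_of_le_of_ne (hle h.le) fun heq => h.not_ge ?_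
    have hinj : Function.Injective S.arrow.hom.hom :=
      (ModuleCat.mono_iff_injective _).1
        (inferInstanceAs (Mono ((forget₂ (FGModuleCat R) (ModuleCat R)).map S.arrow)))
    let e := LinearEquiv.ofInjective S.arrow.hom.hom hinj
    let l : (S' : FGModuleCat R) →ₗ[R] (S : FGModuleCat R) := e.symm.toLinearMap ∘ₗ
      LinearMap.codRestrict (r S) S'.arrow.hom.hom (fun x => heq ▸ ⟨x, rfl⟩)
    refine Subobject.le_of_comm (ObjectProperty.homMk (ModuleCat.ofHom l)) ?_
    ext x
    exact congr_arg Subtype.val (e.apply_symm_apply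
      (LinearMap.codRestrict (r S) S'.arrow.hom.hom (fun x => heq ▸ ⟨x, rfl⟩) x))
  rw [IsNoetherianObject, ObjectProperty.is_iff]
  exact hr.wellFoundedGT

end Noetherian

section TStructures

variable {C : Type*} [Category* C] [Preadditive C] [HasZeroObject C] [HasShift C ℤ]
  [∀ n : ℤ, (shiftFunctor C n).Additive] [Pretriangulated C] (t : TStructure C)

lemma isLE₃ (T : Triangle C) (hT : T ∈ distTriang C) (n : ℤ) (h₁ : t.IsLE T.obj₁ (n + 1))
    (h₂ : t.IsLE T.obj₂ n) : t.IsLE T.obj₃ n :=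
  t.isLE₂ _ (rot_of_distTriang _ hT) n h₂ (t.isLE_shift T.obj₁ (n + 1) 1 n)

lemma isGE₁ (T : Triangle C) (hT : T ∈ distTriang C) (n : ℤ) (h₂ : t.IsGE T.obj₂ n)
    (h₃ : t.IsGE T.obj₃ (n - 1)) : t.IsGE T.obj₁ n :=
  t.isGE₂ _ (inv_rot_of_distTriang _ hT) n (t.isGE_shift T.obj₃ (n - 1) (-1) n) h₂

end TStructures

open Db

/-! ### Equivalences of amplitude `[a, a + 2]` and the torsion pair of `ℬ_{a+2}`. -/

section Amplitude

variable {Z : Type*} [Category* Z] [Abelian Z] [HasDerivedCategory.{w₁} Z]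
  {A : Type*} [Category* A] [Abelian A] [HasDerivedCategory.{w₂} A]
  (Φ : Db Z ≌ Db A)

/-- `Φ` has cohomological amplitude in `[a, a + 2]`. -/
structure HasAmplitude (a : ℤ) : Prop where
  isLE : ∀ (X : Db Z) (n : ℤ), t.IsLE X n → t.IsLE (Φ.functor.obj X) (n + a + 2)
  isGE : ∀ (X : Db Z) (n : ℤ), t.IsGE X n → t.IsGE (Φ.functor.obj X) (n + a)

variable {Φ} {a : ℤ}

/-- Aisle and coaisle are each other's orthogonals, and `Hom(ΨY, X) = Hom(Y, ΦX)`: the lower bound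
for `Φ` becomes the upper bound for `Ψ`, and conversely. -/
lemma HasAmplitude.symm (h : HasAmplitude Φ a) : HasAmplitude Φ.symm (-2 - a) where
  isLE Y n hY := by
    refine (t.isLE_iff_orthogonal _ (n - a + 1) (by lia) _).2 fun X f hX => ?_
    have : t.IsLE (Φ.functor.obj (Φ.inverse.obj Y)) n := 
      t.isLE_of_iso (X := Y) (Φ.counitIso.symm.app Y) n
    have := h.isGE X _ hX
    exact Φ.functor.map_injective
      ((t.zero_of_isLE_of_isGE _ n (n - a + 1 + a) (by lia) ‹_› ‹_›).trans
      (Functor.map_zero _ _ _).symm)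
  isGE Y n hY := by
    refine (t.isGE_iff_orthogonal (n - 3 - a) _ (by lia) _).2 fun X f hX => ?_
    have : t.IsGE (Φ.functor.obj (Φ.inverse.obj Y)) n := 
      t.isGE_of_iso (X := Y) (Φ.counitIso.symm.app Y) n
    have := h.isLE X _ hX
    exact Φ.functor.map_injective
      ((t.zero_of_isLE_of_isGE _ (n - 3 - a + a + 2) n (by lia) ‹_› ‹_›).trans
      (Functor.map_zero _ _ _).symm)

namespace HasAmplitude

lemma catX_iff (i : ℤ) (M : Z) : catX Φ i M ↔
    t.IsLE (Φ.functor.obj ((single Z).obj M)) i ∧ t.IsGE (Φ.functor.obj ((single Z).obj M)) i := by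
  refine ⟨fun hM => ⟨(isLE_iff _ _).2 fun j hj => hM j hj.ne', (isGE_iff _ _).2 fun j hj =>
    hM j hj.ne⟩, fun hM j hj => ?_⟩
  rcases lt_or_gt_of_ne hj with hj | hj
  · exact (isGE_iff _ _).1 hM.2 j hj
  · exact (isLE_iff _ _).1 hM.1 j hj

lemma isClosedUnderIsomorphisms_catB (i : ℤ) : (catB Φ i).IsClosedUnderIsomorphisms where
  of_iso e hX := IsZero.of_iso hX
    ((coh A i).mapIso (Φ.functor.mapIso ((single Z).mapIso e.symm)))

lemma containsZero_catB (i : ℤ) : (catB Φ i).ContainsZero where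
  exists_zero := ⟨_, isZero_zero Z, (coh A i).map_isZero (Φ.functor.map_isZero
    ((single Z).map_isZero (isZero_zero Z)))⟩

lemma rightOrthogonal_catB_le : (catB Φ (a + 2)).rightOrthogonal ≤
    (catX Φ a).rightOrthogonal ⊓ (catX Φ (a + 1)).rightOrthogonal :=
  fun _ hE => ⟨fun _ f hV => hE f (hV (a + 2) (by lia)), fun _ f hV => hE f (hV (a + 2) (by lia))⟩

variable (h : HasAmplitude Φ a)
include h

lemma isLE_inverse (Y : Db A) (n : ℤ) (hY : t.IsLE Y n) : t.IsLE (Φ.inverse.obj Y) (n - a) := by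
  have := h.symm.isLE Y n hY
  rwa [show n + (-2 - a) + 2 = n - a by lia] at this

lemma isGE_inverse (Y : Db A) (n : ℤ) (hY : t.IsGE Y n) :
    t.IsGE (Φ.inverse.obj Y) (n - 2 - a) := by
  have := h.symm.isGE Y n hY
  rwa [show n + (-2 - a) = n - 2 - a by lia] at this

lemma isLE_single (M : Z) : t.IsLE (Φ.functor.obj ((single Z).obj M)) (a + 2) := by
  simpa using h.isLE ((single Z).obj M) 0 inferInstance

lemma isGE_single (M : Z) : t.IsGE (Φ.functor.obj ((single Z).obj M)) a := by
  simpa using h.isGE ((single Z).obj M) 0 inferInstance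

lemma catB_top_iff (M : Z) :
    catB Φ (a + 2) M ↔ t.IsLE (Φ.functor.obj ((single Z).obj M)) (a + 1) := by
  refine ⟨fun hM => (isLE_iff _ _).2 fun i hi => ?_, fun hM => (isLE_iff _ _).1 hM _ (by lia)⟩
  rcases (show a + 2 ≤ i by lia).eq_or_lt with rfl | hi'
  · exact hM
  · exact (isLE_iff _ _).1 (h.isLE_single M) i hi'

lemma catB_bot_iff (M : Z) :
    catB Φ a M ↔ t.IsGE (Φ.functor.obj ((single Z).obj M)) (a + 1) := by
  refine ⟨fun hM => (isGE_iff _ _).2 fun i hi => ?_, fun hM => (isGE_iff _ _).1 hM _ (by lia)⟩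
  rcases (show i ≤ a by lia).eq_or_lt with rfl | hi'
  · exact hM
  · exact (isGE_iff _ _).1 (h.isGE_single M) i hi'

variable [Φ.functor.CommShift ℤ] [Φ.functor.IsTriangulated]

/-- `Φ` of the kernel may reach degree `a + 2`, the top of the amplitude, but it enters the cone
shifted by one and so does not disturb the bound `a + 1`. -/
lemma isClosedUnderQuotients : (catB Φ (a + 2)).IsClosedUnderQuotients where
  prop_of_epi {X Y} f _ hX := by
    rw [h.catB_top_iff] at hX ⊢
    have hS : (ShortComplex.mk (kernel.ι f) f (kernel.condition f)).ShortExact :=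
      { exact := ShortComplex.exact_kernel f
        mono_f := inferInstanceAs (Mono (kernel.ι f))
        epi_g := ‹_› }
    obtain ⟨δ, hT⟩ := exists_triangle_of_shortExact hS
    exact isLE₃ t _ (Φ.functor.map_distinguished _ hT) (a + 1)
      (by rw [add_assoc]; exact h.isLE_single _) hX

lemma isClosedUnderSubobjects : (catB Φ a).IsClosedUnderSubobjects where
  prop_of_mono {X Y} f _ hX := by
    rw [h.catB_bot_iff] at hX ⊢
    have hS : (ShortComplex.mk f (cokernel.π f) (cokernel.condition f)).ShortExact :=
      { exact := ShortComplex.exact_cokernel f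
        mono_f := ‹_›
        epi_g := inferInstanceAs (Epi (cokernel.π f)) }
    obtain ⟨δ, hT⟩ := exists_triangle_of_shortExact hS
    exact isGE₁ t _ (Φ.functor.map_distinguished _ hT) (a + 1) hX
      (by rw [add_sub_cancel_right]; exact h.isGE_single _)

lemma isClosedUnderExtensions : (catB Φ (a + 2)).IsClosedUnderExtensions where
  prop_X₂_of_shortExact hS h₁ h₃ := by
    rw [h.catB_top_iff] at h₁ h₃ ⊢
    obtain ⟨δ, hT⟩ := exists_triangle_of_shortExact hS
    exact t.isLE₂ _ (Φ.functor.map_distinguished _ hT) (a + 1) h₁ h₃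

/-- For `X ∈ D^{≤ 0}`, the object `H^0(X)` lies in `ℬ_{a+2}` exactly when `Φ(X) ∈ D^{≤ a + 1}`. -/
lemma catB_coh_zero_iff (X : Db Z) (hX : t.IsLE X 0) :
    catB Φ (a + 2) ((coh Z 0).obj X) ↔ t.IsLE (Φ.functor.obj X) (a + 1) := by
  obtain ⟨K, M, i, p, δ, hK, hT⟩ := exists_triangle_to_single X
  have hiso := coh_isIso₂ _ hT 0 1 rfl ((isLE_iff _ _).1 hK 0 (by lia))
    ((isLE_iff _ _).1 hK 1 (by lia))
  have := isClosedUnderIsomorphisms_catB (Φ := Φ) (a + 2)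
  rw [(catB Φ (a + 2)).prop_iff_of_iso
    ((@asIso _ _ _ _ _ hiso : (coh Z 0).obj X ≅ _) ≪≫ cohSingleIso M), h.catB_top_iff]
  have hT' := Φ.functor.map_distinguished _ hT
  -- Since `K` lies in `D^{≤ -1}`, it cannot contribute in degree `a + 2`, so `Φ(X)` and `Φ(M)`
  -- satisfy the bound together.
  have hK' : t.IsLE (Φ.functor.obj K) (a + 1) := by
    have := h.isLE K _ hK
    rwa [show -1 + a + 2 = a + 1 by lia] at this
  exact ⟨fun hM => t.isLE₂ _ hT' (a + 1) hK' hM,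
    fun hX => isLE₃ t _ hT' (a + 1) (t.isLE_of_le (Φ.functor.obj K) (a + 1) (a + 1 + 1)) hX⟩

lemma catB_coh_iff (X : Db Z) (n : ℤ) (hX : t.IsLE X n) :
    catB Φ (a + 2) ((coh Z n).obj X) ↔ t.IsLE (Φ.functor.obj X) (n + a + 1) := by
  have := isClosedUnderIsomorphisms_catB (Φ := Φ) (a + 2)
  rw [← (catB Φ (a + 2)).prop_iff_of_iso (cohShiftIso n 0 n (add_zero n) X),
    h.catB_coh_zero_iff _ (t.isLE_shift X n n 0), ← t.isLE_shift_iff _ (n + a + 1) n (a + 1)]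
  have e : Φ.functor.obj (X⟦n⟧) ≅ (Φ.functor.obj X)⟦n⟧ := (Φ.functor.commShiftIso n).app X
  exact ⟨fun _ => t.isLE_of_iso e _, fun _ => t.isLE_of_iso e.symm _⟩

/-- The image of a map from `ℬ_{a+2}` to `ℬ_a` lies in both classes, as a quotient of one and a
subobject of the other. All its `Φ^j` with `j ≠ a + 1` then vanish, so it lies in `𝒳_{a+1}`. -/
lemma catB_inf_rightOrthogonal_le :
    catB Φ a ⊓ (catX Φ (a + 1)).rightOrthogonal ≤ (catB Φ (a + 2)).rightOrthogonal := by
  rintro E ⟨hE, hE'⟩ V f hV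
  have := h.isClosedUnderQuotients
  have := h.isClosedUnderSubobjects
  have h₁ : catB Φ (a + 2) (Abelian.image f) :=
    (catB Φ (a + 2)).prop_of_epi (Abelian.factorThruImage f) hV
  have h₂ : catB Φ a (Abelian.image f) := (catB Φ a).prop_of_mono (Abelian.image.ι f) hE
  rw [← Abelian.image.fac f, hE' (Abelian.image.ι f)
    ((catX_iff _ _).2 ⟨(h.catB_top_iff _).1 h₁, (h.catB_bot_iff _).1 h₂⟩), comp_zero]

lemma isTorsionPair (hZ : ∀ E : Z, IsNoetherianObject E) :
    IsTorsionPair (catB Φ (a + 2)) (catB Φ (a + 2)).rightOrthogonal :=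
  have := h.isClosedUnderQuotients
  have := h.isClosedUnderExtensions
  have := isClosedUnderIsomorphisms_catB (Φ := Φ) (a + 2)
  have := containsZero_catB (Φ := Φ) (a + 2)
  isTorsionPair_rightOrthogonal hZ _

variable [Φ.inverse.CommShift ℤ] [Φ.inverse.IsTriangulated]

omit [Φ.functor.CommShift ℤ] [Φ.functor.IsTriangulated] in
-- The lowest truncation `K = τ^{≤ a} Φ(E)` corresponds under `Ψ` to an object of `𝒳_a`. If `E`
-- receives no map from it, then `K ⟶ Φ(E)` is zero.
lemma rightOrthogonal_catX_le : (catX Φ a).rightOrthogonal ≤ catB Φ a := by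
  intro E hE
  rw [h.catB_bot_iff]
  obtain ⟨K, B, i, p, δ, hT, hK, hB, hK', -⟩ :=
    exists_truncation_triangle t (Φ.functor.obj ((single Z).obj E)) a (a + 1) rfl
  have hK' := hK' a (h.isGE_single E)
  have e : (single Z).obj E ≅ Φ.inverse.obj (Φ.functor.obj ((single Z).obj E)) :=
    Φ.unitIso.app _
  have h₁ : t.IsLE (Φ.inverse.obj K) 0 := by simpa using h.isLE_inverse K a hK
  -- `Ψ(B)` lies in `D^{≥ -1}`, and `Ψ(Φ(E)) ≅ E`; the rotation of the triangle gains the missing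
  -- degree.
  have h₂ : t.IsGE (Φ.inverse.obj K) 0 :=
    isGE₁ t _ (Φ.inverse.map_distinguished _ hT) 0 (t.isGE_of_iso e 0) (by
      have := h.isGE_inverse B _ hB
      rwa [show a + 1 - 2 - a = 0 - 1 by lia] at this)
  obtain ⟨N, ⟨e'⟩⟩ := exists_iso_single (Φ.inverse.obj K)
  have eK : K ≅ Φ.functor.obj ((single Z).obj N) :=
    (Φ.counitIso.app K).symm ≪≫ Φ.functor.mapIso e'
  have hN : catX Φ a N := (catX_iff a N).2 ⟨t.isLE_of_iso eK a, t.isGE_of_iso eK a⟩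
  obtain ⟨k, hk⟩ := (single Z).map_surjective (e'.inv ≫ Φ.inverse.map i ≫ e.inv)
  rw [hE k hN, Functor.map_zero] at hk
  have hi : i = 0 := Φ.inverse.map_injective (by
    rw [Functor.map_zero, ← cancel_epi e'.inv, ← cancel_mono e.inv, Category.assoc, ← hk,
      comp_zero, zero_comp])
  -- Every map from `D^{≤ a}` to `Φ(E)` factors through `i`, which is zero.
  refine (t.isGE_iff_orthogonal a (a + 1) rfl _).2 fun Y f hY => ?_
  obtain ⟨l, hl⟩ := exists_lift_of_distinguished hT f (t.zero _ a (a + 1))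
  rw [hl, hi, comp_zero]

lemma rightOrthogonal_catB_eq : (catB Φ (a + 2)).rightOrthogonal =
    (catX Φ a).rightOrthogonal ⊓ (catX Φ (a + 1)).rightOrthogonal :=
  le_antisymm rightOrthogonal_catB_le
    ((inf_le_inf_right _ h.rightOrthogonal_catX_le).trans h.catB_inf_rightOrthogonal_le)

lemma rightOrthogonal_catB_eq' : (catB Φ (a + 2)).rightOrthogonal =
    catB Φ a ⊓ (catX Φ (a + 1)).rightOrthogonal :=
  le_antisymm (rightOrthogonal_catB_le.trans (inf_le_inf_right _ h.rightOrthogonal_catX_le))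
    h.catB_inf_rightOrthogonal_le

end HasAmplitude
end Amplitude

/-! ### Comparison of the two tilted t-structures. -/

section Comparison

variable {Z : Type*} [Category* Z] [Abelian Z] [HasDerivedCategory.{w₁} Z]
  {A : Type*} [Category* A] [Abelian A] [HasDerivedCategory.{w₂} A]
  {Φ : Db Z ≌ Db A} {a : ℤ}

/-- Replacing `(Φ, X, a, n)` by `(Ψ, Φ(X), -2 - a, n + a + 1)` merely interchanges the two bounds,
which is what makes the tilts on both sides agree. -/
lemma HasAmplitude.tiltTStructure_isLE_iff [Φ.functor.CommShift ℤ] [Φ.functor.IsTriangulated]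
    (h : HasAmplitude Φ a) {ℱ : ObjectProperty Z} (hp : IsTorsionPair (catB Φ (a + 2)) ℱ)
    (X : Db Z) (n : ℤ) : (tiltTStructure hp).IsLE X n ↔
      t.IsLE X n ∧ t.IsLE (Φ.functor.obj X) (n + a + 1) := by
  rw [← TStructure.le_iff_isLE]
  exact and_congr_right fun hX => h.catB_coh_iff X n hX

variable [Φ.functor.CommShift ℤ] [Φ.functor.IsTriangulated] [Φ.inverse.CommShift ℤ]
  [Φ.inverse.IsTriangulated] (h : HasAmplitude Φ a)
  {ℱ : ObjectProperty Z} (hp : IsTorsionPair (catB Φ (a + 2)) ℱ)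
  {ℱ' : ObjectProperty A} (hp' : IsTorsionPair (catB Φ.symm (-2 - a + 2)) ℱ')

include h

lemma HasAmplitude.tiltTStructure_isLE_functor_iff (X : Db Z) (n m : ℤ) (hm : n + a + 1 = m) :
    (tiltTStructure hp').IsLE (Φ.functor.obj X) m ↔ (tiltTStructure hp).IsLE X n := by
  rw [h.tiltTStructure_isLE_iff, h.symm.tiltTStructure_isLE_iff, hm,
    show m + (-2 - a) + 1 = n by lia, and_comm]
  exact and_congr_left fun _ => ⟨fun (_ : t.IsLE (Φ.inverse.obj (Φ.functor.obj X)) n) =>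
      t.isLE_of_iso (X := Φ.inverse.obj (Φ.functor.obj X)) (Φ.unitIso.symm.app X) n,
    fun _ => t.isLE_of_iso (X := X) (Φ.unitIso.app X) n⟩

/-- A coaisle is the right orthogonal of the aisle, and the equivalence already matches the aisles.
-/
lemma HasAmplitude.tiltTStructure_isGE_functor_iff (X : Db Z) (n m : ℤ) (hm : n + a + 1 = m) :
    (tiltTStructure hp').IsGE (Φ.functor.obj X) m ↔ (tiltTStructure hp).IsGE X n := by
  rw [(tiltTStructure hp').isGE_iff_orthogonal (m - 1) m (by lia),
    (tiltTStructure hp).isGE_iff_orthogonal (n - 1) n (by lia)]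
  constructor
  · intro hX Y f hY
    rw [← h.tiltTStructure_isLE_functor_iff hp hp' Y (n - 1) (m - 1) (by lia)] at hY
    exact Φ.functor.map_injective ((hX _ _ hY).trans (Functor.map_zero _ _ _).symm)
  · intro hX Y f hY
    have e : Φ.functor.obj (Φ.inverse.obj Y) ≅ Y := Φ.counitIso.app Y
    obtain ⟨g, hg⟩ := Φ.functor.map_surjective (e.hom ≫ f)
    have := hX _ g ((h.tiltTStructure_isLE_functor_iff hp hp' _ _ (m - 1) (by lia)).1
      ((tiltTStructure hp').isLE_of_iso e.symm _))
    rw [← cancel_epi e.hom, ← hg, this, Functor.map_zero, comp_zero]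

include hp hp' in
/-- The tilt of `Z` at `ℬ_{a+2}` is carried by `Φ[a+1]` to the tilt of `A` at `𝒞_{-a}`. -/
lemma HasAmplitude.tilt_functor_shift_iff (X : Db Z) (m : ℤ) (hm : a + 1 = m) :
    tilt (catB Φ.symm (-2 - a + 2)) ℱ' ((Φ.functor.obj X)⟦m⟧) ↔ tilt (catB Φ (a + 2)) ℱ X := by
  rw [← tiltTStructure_heart hp, ← tiltTStructure_heart hp', TStructure.mem_heart_iff,
    TStructure.mem_heart_iff, TStructure.isLE_shift_iff _ _ m m 0,
    TStructure.isGE_shift_iff _ _ m m 0,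
    h.tiltTStructure_isLE_functor_iff hp hp' X 0 m (by lia),
    h.tiltTStructure_isGE_functor_iff hp hp' X 0 m (by lia)]

end Comparison

lemma tilt_isClosedUnderIsomorphisms {W : Type u} [Category.{v} W] [Abelian W]
    [HasDerivedCategory.{w} W] (𝒯 ℱ : ObjectProperty W) [𝒯.IsClosedUnderIsomorphisms]
    [ℱ.IsClosedUnderIsomorphisms] : (tilt (W := W) 𝒯 ℱ).IsClosedUnderIsomorphisms where
  of_iso e hX := ⟨fun i hi hi' => (hX.1 i hi hi').of_iso ((coh W i).mapIso e.symm),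
    ℱ.prop_of_iso ((coh W _).mapIso e) hX.2.1, 𝒯.prop_of_iso ((coh W _).mapIso e) hX.2.2⟩

/-! ### The amplitude of a tilting equivalence. -/

section Tilting

variable {Z : Type u} [Category.{v} Z] [Abelian Z] [HasDerivedCategory.{w₁} Z] {T : Z}
  [IsNoetherianRing (End T)ᵐᵒᵖ] [HasDerivedCategory.{w₂} (ModOp T)]

lemma RepresentsHom.isZero_coh {Φ : Db Z ⥤ Db (ModOp T)} [Φ.CommShift ℤ] (hΦ : RepresentsHom T Φ)
    (X : Db Z) (i : ℤ) (hX : ∀ f : (single Z).obj T ⟶ X⟦i⟧, f = 0) :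
    IsZero ((coh (ModOp T) i).obj (Φ.obj X)) := by
  obtain ⟨e, -, -⟩ := hΦ
  have h₀ : IsZero ((coh (ModOp T) 0).obj (Φ.obj (X⟦i⟧))) := by
    rw [IsZero.iff_id_eq_zero]
    ext x
    exact (e (X⟦i⟧)).injective ((hX _).trans (hX _).symm)
  exact h₀.of_iso ((cohShiftIso i 0 i (add_zero i) _).symm ≪≫
    (coh (ModOp T) 0).mapIso ((Φ.commShiftIso i).symm.app X))

variable {Φ : Db Z ≌ Db (ModOp T)} [Φ.functor.CommShift ℤ]

/-- A tilting equivalence has amplitude `[0, 2]` if the homological dimension is at most `2`. -/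
lemma IsTilting.hasAmplitude (hT : IsTilting T Φ) (hdim : HomologicalDimensionLE Z 2) :
    HasAmplitude Φ 0 := by
  have := hT.isTriangulated
  refine ⟨fun X n hX => ?_, fun X n hX => (isGE_iff _ _).2 fun i hi =>
    hT.representsHom.isZero_coh X i fun f => ?_⟩
  · have hsingle (M : Z) : t.IsLE (Φ.functor.obj ((single Z).obj M)) 2 :=
      (isLE_iff _ _).2 fun i hi => hT.representsHom.isZero_coh _ i
        (hdim T M i fun hi' => hi.not_ge hi'.2)
    obtain ⟨m, hm⟩ := exists_isGE X
    -- Induction on the length `k` of the interval `[n - k + 1, n]` carrying the cohomology; for `k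
    -- = 0` it is empty and `X = 0`. The inductive step splits off the top cohomology, a shifted
    -- object of `Z`.
    suffices H : ∀ (k : ℕ) (X : Db Z) (n : ℤ), t.IsLE X n → t.IsGE X (n - k + 1) →
        t.IsLE (Φ.functor.obj X) (n + 2) by
      rw [add_zero]
      exact H (n + 1 - m).toNat X n hX (t.isGE_of_ge X _ m)
    intro k
    induction k with
    | zero =>
      intro X n hX hX'
      have hX0 : IsZero X := t.isZero X n (n - (0 : ℕ) + 1)
      exact (isLE_iff _ _).2 fun i _ => Functor.map_isZero _ (Φ.functor.map_isZero hX0)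
    | succ k ih =>
      intro X n hX hX'
      obtain ⟨K, B, i, p, δ, hT, hK, hB, hK', hB'⟩ :=
        exists_truncation_triangle t X (n - 1) n (by lia)
      have hΦK := ih K (n - 1) hK (by
        have := hK' _ hX'
        rwa [show n - 1 - (k : ℤ) + 1 = n - ((k + 1 : ℕ) : ℤ) + 1 by push_cast; ring])
      have := hB' n hX
      have := t.isLE_shift B n n 0
      have := t.isGE_shift B n n 0
      obtain ⟨M, ⟨e⟩⟩ := exists_iso_single (B⟦n⟧)
      have eB : Φ.functor.obj ((single Z).obj M) ≅ (Φ.functor.obj B)⟦n⟧ :=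
        Φ.functor.mapIso e.symm ≪≫ (Φ.functor.commShiftIso n).app B
      have := t.isLE_of_iso eB 2
      exact t.isLE₂ _ (Φ.functor.map_distinguished _ hT) (n + 2)
        (t.isLE_of_le (Φ.functor.obj K) (n - 1 + 2) (n + 2))
        (t.isLE_of_shift (Φ.functor.obj B) (n + 2) n 2)
  -- For `i < n` the target `X[i]` lies in `D^{≥ 1}`, while `T` sits in degree `0`.
  · have := t.isGE_shift X n i (n - i)
    exact t.zero f 0 (n - i)

end Tilting

/-! ### The images of `𝒰_{2,1}`, `𝒯` and `ℱ` in `D(A)`. -/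

section Images

variable {Z : Type*} [Category* Z] [Abelian Z] [HasDerivedCategory.{w₁} Z]
  {A : Type*} [Category* A] [Abelian A] [HasDerivedCategory.{w₂} A]
  {Φ : Db Z ≌ Db A}

lemma imageShift_iff (P : ObjectProperty (Db Z)) (Y : Db A) :
    imageShift Φ P Y ↔ ∃ X, P X ∧ Nonempty ((Φ.functor.obj X)⟦(1 : ℤ)⟧ ≅ Y) := by
  constructor
  · rintro ⟨Y', ⟨X, hX, ⟨e⟩⟩, ⟨e'⟩⟩
    exact ⟨X, hX, ⟨(shiftFunctor _ (1 : ℤ)).mapIso e ≪≫ e'⟩⟩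
  · rintro ⟨X, hX, ⟨e⟩⟩
    exact ⟨_, ⟨X, hX, ⟨Iso.refl _⟩⟩, ⟨e⟩⟩

lemma exists_functor_obj_shift_iso (Y : Db A) (n : ℤ) :
    ∃ X : Db Z, Nonempty ((Φ.functor.obj X)⟦n⟧ ≅ Y) :=
  ⟨Φ.inverse.obj (Y⟦-n⟧), ⟨(shiftFunctor _ n).mapIso (Φ.counitIso.app (Y⟦-n⟧)) ≪≫
    (shiftEquiv (Db A) n).counitIso.app Y⟩⟩

lemma catH_iff (X : Db Z) :
    catH Φ X ↔ ∃ M : A, Nonempty ((single A).obj M ≅ Φ.functor.obj X) := by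
  constructor
  · rintro ⟨M, -, ⟨e⟩⟩
    exact ⟨M, ⟨(Φ.counitIso.app ((single A).obj M)).symm ≪≫ Φ.functor.mapIso e⟩⟩
  · rintro ⟨M, ⟨e⟩⟩
    exact ⟨M, trivial, ⟨Φ.inverse.mapIso e ≪≫ (Φ.unitIso.app X).symm⟩⟩

variable [Φ.functor.CommShift ℤ]

lemma functor_shift_shift_iso (X : Db Z) :
    Nonempty ((Φ.functor.obj (X⟦(-1 : ℤ)⟧))⟦(1 : ℤ)⟧ ≅ Φ.functor.obj X) :=
  ⟨((Φ.functor.commShiftIso (1 : ℤ)).symm.app (X⟦(-1 : ℤ)⟧)) ≪≫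
    Φ.functor.mapIso ((shiftEquiv (Db Z) (1 : ℤ)).counitIso.app X)⟩

variable {𝒯 ℱ : ObjectProperty A}

lemma tilt_single_iff (h : IsTorsionPair 𝒯 ℱ) (M : A) :
    tilt 𝒯 ℱ ((single A).obj M) ↔ 𝒯 M := by
  have := h.torsion_iso
  rw [← 𝒯.prop_iff_of_iso (cohSingleIso M)]
  exact ⟨fun hM => hM.2.2, fun hM => ⟨fun i hi hi' => by
    rcases lt_or_gt_of_ne hi' with hi' | hi'
    · exact (isGE_iff _ _).1 (inferInstanceAs (t.IsGE ((single A).obj M) 0)) i hi'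
    · exact (isLE_iff _ _).1 (inferInstanceAs (t.IsLE ((single A).obj M) 0)) i hi',
    h.prop_of_isZero_right ((isGE_iff _ 0).1
      (inferInstanceAs (t.IsGE ((single A).obj M) 0)) (-1) (by lia)), hM⟩⟩

lemma tilt_single_shift_iff (h : IsTorsionPair 𝒯 ℱ) (M : A) :
    tilt 𝒯 ℱ (((single A).obj M)⟦(1 : ℤ)⟧) ↔ ℱ M := by
  have := h.torsionFree_iso
  have h₁ := t.isLE_shift ((single A).obj M) 0 1 (-1)
  have h₂ := t.isGE_shift ((single A).obj M) 0 1 (-1)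
  rw [← ℱ.prop_iff_of_iso (cohShiftIso 1 (-1) 0 rfl _ ≪≫ cohSingleIso M)]
  exact ⟨fun hM => hM.2.1, fun hM => ⟨fun i hi hi' => by
    rcases lt_or_gt_of_ne hi with hi | hi
    · exact (isGE_iff _ _).1 h₂ i hi
    · exact (isLE_iff _ _).1 h₁ i hi, hM,
    h.prop_of_isZero_left ((isLE_iff _ _).1 h₁ 0 (by lia))⟩⟩

variable (h : IsTorsionPair 𝒯 ℱ)
  (hU : ∀ X, tilt 𝒯 ℱ ((Φ.functor.obj X)⟦(1 : ℤ)⟧) ↔ catU Φ X)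

include h hU

omit [Φ.functor.CommShift ℤ] in
lemma imageShift_catU : imageShift Φ (catU Φ) = tilt 𝒯 ℱ := by
  have := h.torsion_iso
  have := h.torsionFree_iso
  have := tilt_isClosedUnderIsomorphisms 𝒯 ℱ
  ext Y
  rw [imageShift_iff]
  constructor
  · rintro ⟨X, hX, ⟨e⟩⟩
    exact (tilt 𝒯 ℱ).prop_of_iso e ((hU X).2 hX)
  · intro hY
    obtain ⟨X, ⟨e⟩⟩ := exists_functor_obj_shift_iso (Φ := Φ) Y 1
    exact ⟨X, (hU X).1 ((tilt 𝒯 ℱ).prop_of_iso e.symm hY), ⟨e⟩⟩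

/-- For `X` in `ℋ[-1]` the object `Φ(X)[1]` is a module in degree `0`, and such a module lies in the
tilt exactly when it is torsion. -/
lemma imageShift_tors : imageShift Φ (tors Φ) = 𝒯.map (single A) := by
  have := h.torsion_iso
  have := h.torsionFree_iso
  have := tilt_isClosedUnderIsomorphisms 𝒯 ℱ
  ext Y
  rw [imageShift_iff]
  constructor
  · rintro ⟨X, ⟨hX, X', hX', ⟨e⟩⟩, ⟨e'⟩⟩
    obtain ⟨M, ⟨e₁⟩⟩ := (catH_iff X').1 hX'
    obtain ⟨e₂⟩ := functor_shift_shift_iso (Φ := Φ) X'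
    have e₃ : (single A).obj M ≅ (Φ.functor.obj X)⟦(1 : ℤ)⟧ :=
      e₁ ≪≫ e₂.symm ≪≫ (shiftFunctor _ (1 : ℤ)).mapIso (Φ.functor.mapIso e)
    exact ⟨M, (tilt_single_iff h M).1 ((tilt 𝒯 ℱ).prop_of_iso e₃.symm ((hU X).2 hX)),
      ⟨e₃ ≪≫ e'⟩⟩
  · rintro ⟨M, hM, ⟨e⟩⟩
    let X' := Φ.inverse.obj ((single A).obj M)
    have e₁ : Φ.functor.obj X' ≅ (single A).obj M := Φ.counitIso.app _
    obtain ⟨e₂⟩ := functor_shift_shift_iso (Φ := Φ) X'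
    exact ⟨X'⟦(-1 : ℤ)⟧, ⟨(hU _).1 ((tilt 𝒯 ℱ).prop_of_iso (e₂ ≪≫ e₁).symm
      ((tilt_single_iff h M).2 hM)), X', (catH_iff X').2 ⟨M, ⟨e₁.symm⟩⟩, ⟨Iso.refl _⟩⟩,
      ⟨e₂ ≪≫ e₁ ≪≫ e⟩⟩

/-- The shifts `[-1]` and `[1]` cancel, leaving the modules `M = Φ(X')` with `X'` in `𝒰_{2,1}`; this
says that `M[1]` lies in the tilt, so that `M` is torsion-free. -/
lemma imageShift_torsFree : imageShift Φ (torsFree Φ) = ℱ.map (single A) := by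
  have := h.torsion_iso
  have := h.torsionFree_iso
  have := tilt_isClosedUnderIsomorphisms 𝒯 ℱ
  ext Y
  rw [imageShift_iff]
  constructor
  · rintro ⟨X, ⟨X', ⟨hX, hX'⟩, ⟨e⟩⟩, ⟨e'⟩⟩
    obtain ⟨M, ⟨e₁⟩⟩ := (catH_iff X').1 hX'
    obtain ⟨e₂⟩ := functor_shift_shift_iso (Φ := Φ) X'
    exact ⟨M, (tilt_single_shift_iff h M).1 ((tilt 𝒯 ℱ).prop_of_iso
      ((shiftFunctor _ (1 : ℤ)).mapIso e₁.symm) ((hU X').2 hX)),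
      ⟨e₁ ≪≫ e₂.symm ≪≫ (shiftFunctor _ (1 : ℤ)).mapIso (Φ.functor.mapIso e) ≪≫ e'⟩⟩
  · rintro ⟨M, hM, ⟨e⟩⟩
    let X' := Φ.inverse.obj ((single A).obj M)
    have e₁ : Φ.functor.obj X' ≅ (single A).obj M := Φ.counitIso.app _
    obtain ⟨e₂⟩ := functor_shift_shift_iso (Φ := Φ) X'
    exact ⟨X'⟦(-1 : ℤ)⟧, ⟨X', ⟨(hU _).1 ((tilt 𝒯 ℱ).prop_of_iso
      ((shiftFunctor _ (1 : ℤ)).mapIso e₁.symm) ((tilt_single_shift_iff h M).2 hM)),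
      (catH_iff X').2 ⟨M, ⟨e₁.symm⟩⟩⟩, ⟨Iso.refl _⟩⟩, ⟨e₂ ≪≫ e₁ ≪≫ e⟩⟩

end Images

end TiltingTorsion

open TiltingTorsion in
theorem lemma10 {Z : Type u} [Category.{v} Z] [Abelian Z] [HasDerivedCategory.{w₁} Z]
    (hnoeth : ∀ E : Z, IsNoetherianObject E)
    (hdim : HomologicalDimensionLE Z 2)
    (T : Z) [IsNoetherianRing (End T)ᵐᵒᵖ] [HasDerivedCategory.{w₂} (ModOp T)]
    (Φ : Db Z ≌ Db (ModOp T)) [Φ.functor.CommShift ℤ] (hT : IsTilting T Φ) :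
    -- the tilt of `Z`, i.e. the left column of the diagram
    (IsTorsionPair (catB Φ 2) ((catX Φ 0).rightOrthogonal ⊓ (catX Φ 1).rightOrthogonal) ∧
      catU Φ = tilt (catB Φ 2) ((catX Φ 0).rightOrthogonal ⊓ (catX Φ 1).rightOrthogonal) ∧
      IsBoundedHeart (catU Φ)) ∧
    -- the tilt of `mod A^op`, i.e. the right column of the diagram
    (IsTorsionPair (catC Φ 0)
        ((catY Φ (-1)).rightOrthogonal ⊓ (catY Φ (-2)).rightOrthogonal) ∧
      imageShift Φ (catU Φ) = tilt (catC Φ 0)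
        ((catY Φ (-1)).rightOrthogonal ⊓ (catY Φ (-2)).rightOrthogonal) ∧
      IsBoundedHeart (imageShift Φ (catU Φ))) ∧
    -- this torsion pair of `mod A^op` is `(Φ 𝒯[1], Φ ℱ[1])`
    imageShift Φ (tors Φ) = (catC Φ 0).map (Db.single (ModOp T)) ∧
    imageShift Φ (torsFree Φ) =
      ((catY Φ (-1)).rightOrthogonal ⊓ (catY Φ (-2)).rightOrthogonal).map
        (Db.single (ModOp T)) := by
  have := hT.isTriangulated
  -- `Ψ` receives the shift isomorphisms induced by those of `Φ`, so that the adjunction respects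
  -- shifts and `Ψ` is triangulated as an adjoint.
  let := Φ.commShiftInverse ℤ
  have := Φ.commShift_of_functor ℤ
  have : Φ.inverse.IsTriangulated := Φ.toAdjunction.isTriangulated_rightAdjoint
  have h := hT.hasAmplitude hdim
  have hpZ : IsTorsionPair (catB Φ 2) (catB Φ 2).rightOrthogonal := h.isTorsionPair hnoeth
  -- `𝒞_0` is by definition the class `ℬ_{a+2}` of `Φ.symm` with `a = -2`.
  have hpA : IsTorsionPair (catC Φ 0) (catC Φ 0).rightOrthogonal :=
    h.symm.isTorsionPair isNoetherianObject_fgModuleCat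
  have hZ : (catB Φ 2).rightOrthogonal =
      (catX Φ 0).rightOrthogonal ⊓ (catX Φ 1).rightOrthogonal := h.rightOrthogonal_catB_eq
  have hZ' : (catB Φ 2).rightOrthogonal = catB Φ 0 ⊓ (catX Φ 1).rightOrthogonal :=
    h.rightOrthogonal_catB_eq'
  have hA : (catC Φ 0).rightOrthogonal =
      (catY Φ (-1)).rightOrthogonal ⊓ (catY Φ (-2)).rightOrthogonal :=
    h.symm.rightOrthogonal_catB_eq.trans (inf_comm _ _)
  have hU : catU Φ = tilt (catB Φ 2) (catB Φ 2).rightOrthogonal := by rw [catU, hZ']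
  have hU' (X) : tilt (catC Φ 0) (catC Φ 0).rightOrthogonal ((Φ.functor.obj X)⟦(1 : ℤ)⟧) ↔
      catU Φ X := by
    rw [hU]
    exact h.tilt_functor_shift_iff hpZ hpA X 1 rfl
  have himage := imageShift_catU hpA hU'
  rw [← hZ, ← hA]
  refine ⟨⟨hpZ, hU, ?_⟩, ⟨hpA, himage, ?_⟩, imageShift_tors hpA hU', imageShift_torsFree hpA hU'⟩
  · rw [hU]
    exact isBoundedHeart_tilt hpZ
  · rw [himage]
    exact isBoundedHeart_tilt hpA
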